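/- Let $G$ be a finite connected simple graph with vertex set $\{0,\dots,V-1\}$, $V\ge 1$, and let $R=\mathbb{C}[x_0,\dots,x_{V-1},y_0,\dots,y_{V-1}]$. Let $I_G=\langle f_0,\dots,f_{V-1}\rangle\subseteq R$, where $$f_i=\sum_{j\text{ adjacent to } i}(x_jy_i-x_iy_j),$$ and let $I_\Sigma\subseteq R$ be the ideal generated by the $2\times 2$ minors of the matrix $$\begin{pmatrix}x_0&x_1&\cdots&x_{V-1}\\ y_0&y_1&\cdots&y_{V-1}\end{pmatrix}.$$ Let $\Sigma\subseteq\mathbb{P}^{2V-1}$ be the Segre variety, that is, the image of the map $\mathbb{P}^1\times\mathbb{P}^{V-1}\to\mathbb{P}^{2V-1}$, $([a_0:a_1],[b_0:\cdots:b_{V-1}])\mapsto[a_0b_0:\cdots:a_0b_{V-1}:a_1b_0:\cdots:a_1b_{V-1}]$, where the coordinates of $\mathbb{P}^{2V-1}$ are $x_0,\dots,x_{V-1},y_0,\dots,y_{V-1}$ in this order, and let $\widehat\Sigma\subseteq\mathbb{C}^{2V}$ be its affine cone (the origin together with all vectors representing points of $\Sigma$). Then: 1. $I_\Sigma$ is a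 minimal prime of $I_G$; 2. $I_\Sigma$ is the ideal of all polynomials in $R$ that vanish on $\widehat\Sigma$; 3. $\widehat\Sigma$ is an irreducible component, in the Zariski topology, of the variety $\mathbb{V}(I_G)\subseteq\mathbb{C}^{2V}$ of common zeros of $I_G$. -/

import Mathlib

/-! Coordinates: `ℂ^{2n}` is `Fin 2 × Fin n → ℂ`; the coordinate `(0, i)` is `x_i` and the
coordinate `(1, i)` is `y_i`. -/

namespace Kuramoto

open MvPolynomial LinearAlgebra.Projectivization

noncomputable section

/-- The polynomial ring `ℂ[x_0, …, x_{n-1}, y_0, …, y_{n-1}]`. -/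
abbrev PolyRing (n : ℕ) : Type := MvPolynomial (Fin 2 × Fin n) ℂ

/-- The variable `x_i`. -/
def x {n : ℕ} (i : Fin n) : PolyRing n := X (0, i)

/-- The variable `y_i`. -/
def y {n : ℕ} (i : Fin n) : PolyRing n := X (1, i)

/-- The polynomial `f_i = ∑_{j ∼ i} (x_j y_i - x_i y_j)` of the vertex `i`. -/
def vertexPoly {n : ℕ} (G : SimpleGraph (Fin n)) [DecidableRel G.Adj] (i : Fin n) : PolyRing n :=
  ∑ j ∈ G.neighborFinset i, (x j * y i - x i * y j)

/-- The ideal `I_G = ⟨f_0, …, f_{n-1}⟩`. -/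
def graphIdeal {n : ℕ} (G : SimpleGraph (Fin n)) [DecidableRel G.Adj] : Ideal (PolyRing n) :=
  Ideal.span (Set.range (vertexPoly G))

/-- The `2 × n` matrix with first row `x_0, …, x_{n-1}` and second row `y_0, …, y_{n-1}`. -/
def coordMatrix (n : ℕ) : Matrix (Fin 2) (Fin n) (PolyRing n) :=
  Matrix.of ![x, y]

/-- The ideal `I_Σ` generated by the `2 × 2` minors of `coordMatrix n`. -/
def segreIdeal (n : ℕ) : Ideal (PolyRing n) :=
  Ideal.span {p | ∃ i j : Fin n, i < j ∧ p = ((coordMatrix n).submatrix id ![i, j]).det}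

/-- The outer product `(a_k b_i)_{k, i}` of two vectors. -/
def outer {s t : Type*} (a : s → ℂ) (b : t → ℂ) : s × t → ℂ := fun k => a k.1 * b k.2

theorem outer_ne_zero {s t : Type*} {a : s → ℂ} {b : t → ℂ} (ha : a ≠ 0) (hb : b ≠ 0) :
    outer a b ≠ 0 := by
  obtain ⟨i, hi⟩ := Function.ne_iff.1 ha
  obtain ⟨j, hj⟩ := Function.ne_iff.1 hb
  exact Function.ne_iff.2 ⟨(i, j), mul_ne_zero hi hj⟩

/-- The Segre map `[a] × [b] ↦ [a_k b_i]_{k, i}`; by `segreMap_mk` it does not depend on the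
chosen representatives. -/
def segreMap {s t : Type*} (p : ℙ ℂ (s → ℂ)) (q : ℙ ℂ (t → ℂ)) : ℙ ℂ (s × t → ℂ) :=
  Projectivization.mk ℂ (outer p.rep q.rep) (outer_ne_zero p.rep_nonzero q.rep_nonzero)

theorem segreMap_mk {s t : Type*} (a : s → ℂ) (b : t → ℂ) (ha : a ≠ 0) (hb : b ≠ 0) :
    segreMap (Projectivization.mk ℂ a ha) (Projectivization.mk ℂ b hb) =
      Projectivization.mk ℂ (outer a b) (outer_ne_zero ha hb) := by
  obtain ⟨u, hu⟩ := Projectivization.exists_smul_eq_mk_rep ℂ a ha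
  obtain ⟨v, hv⟩ := Projectivization.exists_smul_eq_mk_rep ℂ b hb
  refine (Projectivization.mk_eq_mk_iff ℂ _ _ _ _).2 ⟨u * v, ?_⟩
  rw [← hu, ← hv]
  funext k
  simp only [outer, Pi.smul_apply, Units.smul_def, Units.val_mul, smul_eq_mul]
  ring

/-- The Segre variety `Σ`, the image of `ℙ¹ × ℙⁿ⁻¹` in `ℙ²ⁿ⁻¹` under the Segre map. -/
def segreVariety (n : ℕ) : Set (ℙ ℂ (Fin 2 × Fin n → ℂ)) :=
  Set.range fun p : ℙ ℂ (Fin 2 → ℂ) × ℙ ℂ (Fin n → ℂ) => segreMap p.1 p.2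

/-- The affine cone over a subset of projective space: the origin together with all the
vectors that represent a point of the set. -/
def affineCone {σ : Type*} (S : Set (ℙ ℂ (σ → ℂ))) : Set (σ → ℂ) :=
  {v | v = 0 ∨ ∃ hv : v ≠ 0, Projectivization.mk ℂ v hv ∈ S}

/-- The Zariski topology on `ℂ^σ`: the closed sets are the zero loci of ideals. -/
abbrev zariskiTopology (σ : Type*) : TopologicalSpace (σ → ℂ) :=
  TopologicalSpace.ofClosed {Z | ∃ I : Ideal (MvPolynomial σ ℂ), Z = zeroLocus ℂ I}
    ⟨⊤, zeroLocus_top.symm⟩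
    (by
      intro A hA
      refine ⟨⨆ I ∈ {I : Ideal (MvPolynomial σ ℂ) | zeroLocus ℂ I ∈ A}, I, ?_⟩
      refine Set.Subset.antisymm ?_ ?_
      · refine le_zeroLocus_iff_le_vanishingIdeal.2 (iSup₂_le fun I hI => ?_)
        exact le_zeroLocus_iff_le_vanishingIdeal.1 (Set.sInter_subset_of_mem hI)
      · intro v hv Z hZ
        obtain ⟨I, rfl⟩ := hA hZ
        exact zeroLocus_anti_mono
          (le_iSup₂ (f := fun (I : Ideal (MvPolynomial σ ℂ))
            (_ : I ∈ {I : Ideal (MvPolynomial σ ℂ) | zeroLocus ℂ I ∈ A}) => I) I hZ) hv)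
    (by
      rintro _ ⟨I, rfl⟩ _ ⟨J, rfl⟩
      refine ⟨I * J, Set.Subset.antisymm ?_ ?_⟩
      · exact Set.union_subset (zeroLocus_anti_mono Ideal.mul_le_left)
          (zeroLocus_anti_mono Ideal.mul_le_right)
      · intro v hv
        by_contra hne
        simp only [Set.mem_union, mem_zeroLocus_iff, not_or, not_forall] at hne
        obtain ⟨⟨p, hp, hpv⟩, q, hq, hqv⟩ := hne
        have h := hv (p * q) (Ideal.mul_mem_mul hp hq)
        rw [map_mul] at h
        exact (mul_ne_zero hpv hqv) h)

/-- The irreducible components, as subsets of `ℂ^σ`, of a subset `Z` of `ℂ^σ` that carries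
the subspace topology of the Zariski topology. -/
def zariskiComponents {σ : Type*} (Z : Set (σ → ℂ)) : Set (Set (σ → ℂ)) :=
  (fun T : Set Z => Subtype.val '' T) ''
    @irreducibleComponents Z ((zariskiTopology σ).induced Subtype.val)

end

end Kuramoto

namespace Kuramoto

open MvPolynomial

/-! Primality of `segreIdeal n` and its equality with the vanishing ideal of the cone both follow
from `ker_segreHom`: the minors generate the kernel of the map X (k, i) ↦ a_k b_i into a domain, and
the cone is exactly the set of outer products. Minimality and the component claim rest on one
polynomial s, the `separator`, with s · I_Σ ⊆ I_G and s ∉ I_Σ. Fix a vertex o. A Laplacian M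
weighted by the x_i sends the vector of minors x_o y_j - x_j y_o to x_o f, so Cramer's rule puts det
M times these minors in I_G; s = x_o det M then handles every minor. At the all-ones point, which
lies on the cone, M becomes the graph Laplacian plus a 1 at (o, o), invertible because G is
connected. -/

theorem X_mul_X_sub_mem_segreIdeal {n : ℕ} (k l : Fin 2) (i j : Fin n) :
    (X (k, j) * X (l, i) - X (k, i) * X (l, j) : PolyRing n) ∈ segreIdeal n := by
  have key : ∀ i j : Fin n, x i * y j - x j * y i ∈ segreIdeal n := by
    have hlt : ∀ i j : Fin n, i < j → x i * y j - x j * y i ∈ segreIdeal n := by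
      intro i j hij
      refine Ideal.subset_span ⟨i, j, hij, ?_⟩
      simp [Matrix.det_fin_two, coordMatrix]
    intro i j
    rcases lt_trichotomy i j with h | rfl | h
    · exact hlt i j h
    · simp
    · rw [← neg_sub]
      exact neg_mem (hlt j i h)
  simp only [x, y] at key
  fin_cases k <;> fin_cases l <;> simp only [Fin.zero_eta, Fin.mk_one]
  · convert (segreIdeal n).zero_mem using 1; ring
  · exact key j i
  · convert key i j using 1; ring
  · convert (segreIdeal n).zero_mem using 1; ring

/-! ### The minors generate a toric prime ideal -/

/-- The algebra homomorphism `X (k, i) ↦ a_k b_i` dual to the outer product. -/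
noncomputable def segreHom (n : ℕ) : PolyRing n →ₐ[ℂ] MvPolynomial (Fin 2 ⊕ Fin n) ℂ :=
  aeval fun p => X (Sum.inl p.1) * X (Sum.inr p.2)

/-- The map on exponents of monomials induced by `segreHom`. -/
noncomputable def segreExp (n : ℕ) : (Fin 2 × Fin n →₀ ℕ) →+ (Fin 2 ⊕ Fin n →₀ ℕ) :=
  Finsupp.mapDomain.addMonoidHom (fun p => Sum.inl p.1) +
    Finsupp.mapDomain.addMonoidHom (fun p => Sum.inr p.2)

theorem segreExp_single {n : ℕ} (p : Fin 2 × Fin n) (c : ℕ) :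
    segreExp n (Finsupp.single p c) =
      Finsupp.single (Sum.inl p.1) c + Finsupp.single (Sum.inr p.2) c := by
  simp [segreExp, Finsupp.mapDomain_single]

theorem segreHom_monomial {n : ℕ} (m : Fin 2 × Fin n →₀ ℕ) (c : ℂ) :
    segreHom n (monomial m c) = monomial (segreExp n m) c := by
  induction m using Finsupp.induction_linear generalizing c with
  | zero =>
    rw [map_zero]
    exact (segreHom n).commutes c
  | add f g hf hg =>
    rw [show (monomial (f + g) c : PolyRing n) = monomial f c * monomial g 1 by
      rw [monomial_mul, mul_one], map_mul, hf, hg, monomial_mul, mul_one, map_add]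
  | single p k =>
    rw [segreExp_single, show (monomial (Finsupp.single p k) c : PolyRing n) = C c * X p ^ k by
      rw [X_pow_eq_monomial, C_mul_monomial, mul_one], map_mul, map_pow, segreHom, aeval_X, aeval_C,
      mul_pow, X_pow_eq_monomial, X_pow_eq_monomial, monomial_mul, algebraMap_eq, C_mul_monomial]
    simp

theorem exists_apply_ne_zero_of_mapDomain_ne_zero {α β : Type*} {f : α → β} {m : α →₀ ℕ} {b : β}
    (h : Finsupp.mapDomain f m b ≠ 0) : ∃ a, f a = b ∧ m a ≠ 0 := by
  classical
  obtain ⟨a, ha, hb⟩ := Finset.mem_image.1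
    (Finsupp.mapDomain_support (Finsupp.mem_support_iff.2 h))
  exact ⟨a, hb, Finsupp.mem_support_iff.1 ha⟩

theorem exists_of_segreExp_inl_ne_zero {n : ℕ} {m : Fin 2 × Fin n →₀ ℕ} {k : Fin 2}
    (h : segreExp n m (Sum.inl k) ≠ 0) : ∃ j, m (k, j) ≠ 0 := by
  have h0 : Finsupp.mapDomain (fun p : Fin 2 × Fin n => (Sum.inr p.2 : Fin 2 ⊕ Fin n)) m
      (Sum.inl k) = 0 := Finsupp.mapDomain_of_notMem_range _ _ (by simp)
  have h1 : Finsupp.mapDomain (fun p : Fin 2 × Fin n => (Sum.inl p.1 : Fin 2 ⊕ Fin n)) m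
      (Sum.inl k) ≠ 0 := by
    intro h1
    exact h (by simp [segreExp, h0, h1])
  obtain ⟨⟨k', j⟩, hk, hm⟩ := exists_apply_ne_zero_of_mapDomain_ne_zero h1
  obtain rfl : k' = k := Sum.inl_injective hk
  exact ⟨j, hm⟩

theorem exists_of_segreExp_inr_ne_zero {n : ℕ} {m : Fin 2 × Fin n →₀ ℕ} {i : Fin n}
    (h : segreExp n m (Sum.inr i) ≠ 0) : ∃ l, m (l, i) ≠ 0 := by
  have h0 : Finsupp.mapDomain (fun p : Fin 2 × Fin n => (Sum.inl p.1 : Fin 2 ⊕ Fin n)) m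
      (Sum.inr i) = 0 := Finsupp.mapDomain_of_notMem_range _ _ (by simp)
  have h1 : Finsupp.mapDomain (fun p : Fin 2 × Fin n => (Sum.inr p.2 : Fin 2 ⊕ Fin n)) m
      (Sum.inr i) ≠ 0 := by
    intro h1
    exact h (by simp [segreExp, h0, h1])
  obtain ⟨⟨l, i'⟩, hk, hm⟩ := exists_apply_ne_zero_of_mapDomain_ne_zero h1
  obtain rfl : i' = i := Sum.inr_injective hk
  exact ⟨l, hm⟩

theorem exists_add_single_of_ne_zero {α : Type*} {m : α →₀ ℕ} {a : α} (h : m a ≠ 0) :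
    ∃ m', m = m' + Finsupp.single a 1 :=
  ⟨m - Finsupp.single a 1, (tsub_add_cancel_of_le
    (Finsupp.single_le_iff.2 (Nat.one_le_iff_ne_zero.2 h))).symm⟩

/-- If row `k` and column `i` both occur in a monomial, then modulo the minors the monomial is
divisible by `X (k, i)`. -/
theorem exists_monomial_sub_mem_segreIdeal {n : ℕ} {m : Fin 2 × Fin n →₀ ℕ} {k : Fin 2} {i : Fin n}
    (hk : segreExp n m (Sum.inl k) ≠ 0) (hi : segreExp n m (Sum.inr i) ≠ 0) :
    ∃ m', segreExp n m = segreExp n (m' + Finsupp.single (k, i) 1) ∧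
      (monomial m 1 - monomial (m' + Finsupp.single (k, i) 1) 1 : PolyRing n) ∈ segreIdeal n := by
  obtain ⟨j, hj⟩ := exists_of_segreExp_inl_ne_zero hk
  obtain ⟨l, hl⟩ := exists_of_segreExp_inr_ne_zero hi
  by_cases hki : m (k, i) = 0
  · have hij : i ≠ j := by rintro rfl; exact hj hki
    obtain ⟨m₁, rfl⟩ := exists_add_single_of_ne_zero hj
    have hl' : m₁ (l, i) ≠ 0 := by
      simpa [Finsupp.single_apply, hij.symm] using hl
    obtain ⟨m₂, rfl⟩ := exists_add_single_of_ne_zero hl'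
    -- Exchange the factor X (k, j) X (l, i) for X (k, i) X (l, j).
    refine ⟨m₂ + Finsupp.single (l, j) 1, ?_, ?_⟩
    · simp only [map_add, segreExp_single]
      abel
    · convert (segreIdeal n).mul_mem_left (monomial m₂ 1)
        (X_mul_X_sub_mem_segreIdeal k l i j) using 1
      simp only [X, mul_sub, monomial_mul, mul_one]
      congr 3 <;> abel
  · obtain ⟨m', rfl⟩ := exists_add_single_of_ne_zero hki
    exact ⟨m', rfl, by simp⟩

/-- Induction on the degree: any variable of m can be made to divide m' modulo the minors, and is
then cancelled from both. -/
theorem monomial_sub_monomial_mem_segreIdeal {n : ℕ} (m m' : Fin 2 × Fin n →₀ ℕ)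
    (h : segreExp n m = segreExp n m') :
    (monomial m 1 - monomial m' 1 : PolyRing n) ∈ segreIdeal n := by
  induction hN : m.degree generalizing m m' with
  | zero =>
    obtain rfl : m = 0 := (Finsupp.degree_eq_zero_iff m).1 hN
    obtain rfl : m' = 0 := by
      by_contra hne
      obtain ⟨⟨k, i⟩, hp⟩ := Finsupp.ne_iff.1 hne
      obtain ⟨m₁, rfl⟩ := exists_add_single_of_ne_zero hp
      have := DFunLike.congr_fun h (Sum.inl k)
      simp [segreExp_single] at this
    simp
  | succ N ih =>
    have hne : m ≠ 0 := by rintro rfl; simp at hN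
    obtain ⟨⟨k, i⟩, hp⟩ := Finsupp.ne_iff.1 hne
    obtain ⟨m₀, rfl⟩ := exists_add_single_of_ne_zero hp
    have hk : segreExp n m' (Sum.inl k) ≠ 0 := by
      rw [← h]; simp [segreExp_single]
    have hi : segreExp n m' (Sum.inr i) ≠ 0 := by
      rw [← h]; simp [segreExp_single]
    obtain ⟨m₁, he, hmem⟩ := exists_monomial_sub_mem_segreIdeal hk hi
    have h01 : segreExp n m₀ = segreExp n m₁ := by
      rw [he, map_add, map_add] at h
      exact add_right_cancel h
    have := ih m₀ m₁ h01 (by simpa using hN)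
    have h2 := (segreIdeal n).mul_mem_right (X (k, i)) this
    have h3 := sub_mem h2 hmem
    convert h3 using 1
    simp only [X, sub_mul, monomial_mul, mul_one]
    abel

theorem ker_segreHom (n : ℕ) : RingHom.ker (segreHom n) = segreIdeal n := by
  refine le_antisymm (fun p hp => ?_) ?_
  · let s : MvPolynomial (Fin 2 ⊕ Fin n) ℂ →ₗ[ℂ] PolyRing n ⧸ segreIdeal n :=
      (basisMonomials _ ℂ).constr ℂ fun μ =>
        Ideal.Quotient.mk _ (monomial (Function.invFun (segreExp n) μ) 1)
    have hs : s ∘ₗ (segreHom n).toLinearMap = (Ideal.Quotient.mkₐ ℂ (segreIdeal n)).toLinearMap := by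
      refine (basisMonomials _ ℂ).ext fun m => ?_
      simp only [coe_basisMonomials, LinearMap.comp_apply, AlgHom.toLinearMap_apply,
        segreHom_monomial, Ideal.Quotient.mkₐ_eq_mk]
      rw [← congr_fun (coe_basisMonomials (Fin 2 ⊕ Fin n) ℂ) (segreExp n m)]
      simp only [s, Module.Basis.constr_basis]
      exact (Ideal.Quotient.mk_eq_mk_iff_sub_mem _ _).2
        (monomial_sub_monomial_mem_segreIdeal _ _ (Function.invFun_eq ⟨m, rfl⟩))
    have := LinearMap.congr_fun hs p
    simp only [LinearMap.comp_apply, AlgHom.toLinearMap_apply, Ideal.Quotient.mkₐ_eq_mk,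
      (RingHom.mem_ker).1 hp, map_zero] at this
    exact Ideal.Quotient.eq_zero_iff_mem.1 this.symm
  · refine Ideal.span_le.2 ?_
    rintro _ ⟨i, j, -, rfl⟩
    simp only [SetLike.mem_coe, RingHom.mem_ker, Matrix.det_fin_two, coordMatrix, segreHom]
    simp [x, y]
    ring

theorem segreIdeal_isPrime (n : ℕ) : (segreIdeal n).IsPrime :=
  ker_segreHom n ▸ RingHom.ker_isPrime _

/-! ### The affine cone and its vanishing ideal -/

theorem affineCone_segreVariety (n : ℕ) :
    affineCone (segreVariety n) = Set.range fun p : (Fin 2 → ℂ) × (Fin n → ℂ) => outer p.1 p.2 := by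
  ext v
  constructor
  · rintro (rfl | ⟨hv, ⟨p, q⟩, hpq⟩)
    · exact ⟨(0, 0), by ext; simp [outer]⟩
    · obtain ⟨c, hc⟩ := (Projectivization.mk_eq_mk_iff ℂ _ _ _ _).1 hpq.symm
      refine ⟨((c : ℂ) • p.rep, q.rep), hc ▸ ?_⟩
      ext
      simp [outer, Units.smul_def, mul_assoc]
  · rintro ⟨⟨a, b⟩, rfl⟩
    by_cases ha : a = 0
    · left; ext; simp [outer, ha]
    by_cases hb : b = 0
    · left; ext; simp [outer, hb]
    exact Or.inr ⟨outer_ne_zero ha hb, (Projectivization.mk ℂ a ha, Projectivization.mk ℂ b hb),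
      segreMap_mk a b ha hb⟩

theorem aeval_outer {n : ℕ} (a : Fin 2 → ℂ) (b : Fin n → ℂ) (p : PolyRing n) :
    aeval (outer a b) p = aeval (Sum.elim a b) (segreHom n p) := by
  rw [segreHom, ← AlgHom.comp_apply]
  congr 1
  ext q
  simp [outer]

theorem vanishingIdeal_affineCone_segreVariety (n : ℕ) :
    vanishingIdeal ℂ (affineCone (segreVariety n)) = segreIdeal n := by
  rw [← ker_segreHom, affineCone_segreVariety]
  ext p
  rw [mem_vanishingIdeal_iff, RingHom.mem_ker, Set.forall_mem_range]
  simp only [aeval_outer]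
  constructor
  · intro h
    refine MvPolynomial.funext fun v => ?_
    simpa [aeval_eq_eval] using h (v ∘ Sum.inl, v ∘ Sum.inr)
  · intro h v
    rw [h, map_zero]

theorem zeroLocus_segreIdeal (n : ℕ) :
    zeroLocus ℂ (segreIdeal n) = affineCone (segreVariety n) := by
  refine Set.Subset.antisymm (fun v hv => ?_) ?_
  · by_cases h0 : v = 0
    · exact Or.inl h0
    obtain ⟨⟨k, i⟩, hki⟩ := Function.ne_iff.1 h0
    rw [affineCone_segreVariety]
    -- Vanishing minors mean rank at most one: every row is a multiple of row k, with ratio read off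
    -- in column i.
    refine ⟨(fun l => v (l, i) / v (k, i), fun j => v (k, j)), ?_⟩
    ext ⟨l, j⟩
    have := hv _ (X_mul_X_sub_mem_segreIdeal k l i j)
    simp only [map_sub, map_mul, aeval_X] at this
    simp only [Pi.zero_apply] at hki
    simp only [outer]
    field_simp
    linear_combination this
  · rw [← vanishingIdeal_affineCone_segreVariety]
    exact zeroLocus_vanishingIdeal_le _

/-! ### The weighted Laplacian and the separator -/

theorem graphIdeal_le_segreIdeal {n : ℕ} (G : SimpleGraph (Fin n)) [DecidableRel G.Adj] :
    graphIdeal G ≤ segreIdeal n := by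
  refine Ideal.span_le.2 ?_
  rintro _ ⟨i, rfl⟩
  exact sum_mem fun j _ => X_mul_X_sub_mem_segreIdeal 0 1 i j

/-- The columns of the Laplacian sum to zero, so adding up the entries of a kernel equation leaves v
o = 0. Then v is in the Laplacian's kernel, hence constant by connectedness, hence zero. -/
theorem det_lapMatrix_add_single_ne_zero {V : Type*} [Fintype V] [DecidableEq V]
    {G : SimpleGraph V} [DecidableRel G.Adj] (hG : G.Connected) (o : V) :
    (G.lapMatrix ℝ + Matrix.single o o 1).det ≠ 0 := by
  intro hdet
  obtain ⟨v, hv0, hv⟩ := Matrix.exists_mulVec_eq_zero_iff.2 hdet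
  rw [Matrix.add_mulVec, Matrix.single_mulVec] at hv
  have hone : (fun _ => (1 : ℝ)) ⬝ᵥ (G.lapMatrix ℝ).mulVec v = 0 := by
    rw [Matrix.dotProduct_mulVec, ← Matrix.mulVec_transpose, (G.isSymm_lapMatrix (R := ℝ)).eq,
      G.lapMatrix_mulVec_const_eq_zero, zero_dotProduct]
  have hvo : v o = 0 := by
    have := congr_arg (fun w => (fun _ => (1 : ℝ)) ⬝ᵥ w) hv
    simp only [dotProduct_add, hone] at this
    simpa [dotProduct, Function.update_apply] using this
  have hL : (G.lapMatrix ℝ).mulVec v = 0 := by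
    simpa [hvo] using hv
  refine hv0 (funext fun i => ?_)
  rw [Pi.zero_apply, ← hvo]
  exact (SimpleGraph.lapMatrix_mulVec_eq_zero_iff_forall_reachable G).1 hL i o
    (hG.preconnected i o)

/-- A Laplacian weighted by the variables `x_i`, corrected in the entry `(o, o)`. -/
noncomputable def weightedLap {n : ℕ} (G : SimpleGraph (Fin n)) [DecidableRel G.Adj] (o : Fin n) :
    Matrix (Fin n) (Fin n) (PolyRing n) :=
  Matrix.diagonal (fun i => ∑ j ∈ G.neighborFinset i, x j) -
    Matrix.diagonal x * G.adjMatrix (PolyRing n) + Matrix.single o o 1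

/-- In row i the y_o terms cancel. The correction at (o, o) contributes nothing, since entry o of
the vector is zero. -/
theorem weightedLap_mulVec {n : ℕ} (G : SimpleGraph (Fin n)) [DecidableRel G.Adj] (o : Fin n) :
    (weightedLap G o).mulVec (fun j => x o * y j - x j * y o) =
      fun i => x o * vertexPoly G i := by
  ext1 i
  rw [weightedLap, Matrix.add_mulVec, Matrix.sub_mulVec, ← Matrix.mulVec_mulVec,
    Matrix.single_mulVec]
  simp only [Pi.add_apply, Pi.sub_apply, Matrix.mulVec_diagonal,
    SimpleGraph.adjMatrix_mulVec_apply, sub_self, mul_zero, Function.update_apply, Pi.zero_apply,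
    ite_self, add_zero, vertexPoly]
  rw [Finset.sum_mul, Finset.mul_sum, Finset.mul_sum, ← Finset.sum_sub_distrib]
  exact Finset.sum_congr rfl fun j _ => by ring

theorem det_weightedLap_mul_mem {n : ℕ} (G : SimpleGraph (Fin n)) [DecidableRel G.Adj]
    (o j : Fin n) : (weightedLap G o).det * (x o * y j - x j * y o) ∈ graphIdeal G := by
  have h := congr_arg (fun w => (weightedLap G o).adjugate.mulVec w j) (weightedLap_mulVec G o)
  simp only [Matrix.mulVec_mulVec, Matrix.adjugate_mul, Matrix.smul_mulVec, Matrix.one_mulVec,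
    Pi.smul_apply, smul_eq_mul] at h
  rw [h]
  simp only [Matrix.mulVec, dotProduct]
  refine Ideal.sum_mem _ fun i _ => ?_
  exact Ideal.mul_mem_left _ _ (Ideal.mul_mem_left _ _ (Ideal.subset_span (Set.mem_range_self i)))

/-- A polynomial that multiplies `segreIdeal n` into `graphIdeal G`. -/
noncomputable def separator {n : ℕ} (G : SimpleGraph (Fin n)) [DecidableRel G.Adj] (o : Fin n) :
    PolyRing n :=
  x o * (weightedLap G o).det

theorem separator_mul_mem {n : ℕ} (G : SimpleGraph (Fin n)) [DecidableRel G.Adj] (o : Fin n)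
    {p : PolyRing n} (hp : p ∈ segreIdeal n) : separator G o * p ∈ graphIdeal G := by
  suffices h : segreIdeal n ≤
      Submodule.comap (LinearMap.mulLeft (PolyRing n) (separator G o)) (graphIdeal G) from h hp
  refine Ideal.span_le.2 ?_
  rintro _ ⟨i, j, -, rfl⟩
  -- With [i j] = x_i y_j - x_j y_i, use x_o [i j] = x_i [o j] - x_j [o i].
  have hi := Ideal.mul_mem_left _ (x i) (det_weightedLap_mul_mem G o j)
  have hj := Ideal.mul_mem_left _ (x j) (det_weightedLap_mul_mem G o i)
  simp only [SetLike.mem_coe, Submodule.mem_comap, LinearMap.mulLeft_apply]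
  convert sub_mem hi hj using 1
  simp [Matrix.det_fin_two, coordMatrix, separator]
  ring

theorem aeval_one_separator_ne_zero {n : ℕ} {G : SimpleGraph (Fin n)} [DecidableRel G.Adj]
    (hG : G.Connected) (o : Fin n) : aeval (1 : Fin 2 × Fin n → ℂ) (separator G o) ≠ 0 := by
  have hmap : (aeval (1 : Fin 2 × Fin n → ℂ)).toRingHom.mapMatrix (weightedLap G o) =
      Complex.ofRealHom.mapMatrix (G.lapMatrix ℝ + Matrix.single o o 1) := by
    ext i j
    simp only [weightedLap, SimpleGraph.lapMatrix, SimpleGraph.degMatrix, x,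
      RingHom.mapMatrix_apply, Matrix.map_apply, Matrix.add_apply, Matrix.sub_apply,
      Matrix.diagonal_mul, Matrix.diagonal_apply, Matrix.single_apply,
      SimpleGraph.adjMatrix_apply]
    by_cases hij : i = j <;> by_cases hi : o = i <;> by_cases hj : o = j <;> by_cases ha : G.Adj i j <;>
      simp_all
  have hdet : aeval (1 : Fin 2 × Fin n → ℂ) (weightedLap G o).det =
      ((G.lapMatrix ℝ + Matrix.single o o 1).det : ℝ) := by
    have := congr_arg Matrix.det hmap
    rw [← RingHom.map_det, ← RingHom.map_det] at this
    exact this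
  rw [separator, map_mul, hdet]
  simpa [x] using det_lapMatrix_add_single_ne_zero hG o

theorem one_mem_affineCone_segreVariety (n : ℕ) :
    (1 : Fin 2 × Fin n → ℂ) ∈ affineCone (segreVariety n) := by
  rw [affineCone_segreVariety]
  exact ⟨(1, 1), by ext; simp [outer]⟩

theorem segreIdeal_mem_minimalPrimes {n : ℕ} {G : SimpleGraph (Fin n)} [DecidableRel G.Adj]
    (hG : G.Connected) : segreIdeal n ∈ (graphIdeal G).minimalPrimes := by
  obtain ⟨o⟩ := hG.nonempty
  refine ⟨⟨segreIdeal_isPrime n, graphIdeal_le_segreIdeal G⟩, ?_⟩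
  rintro P ⟨hP, hGP⟩ hPS p hp
  refine (hP.mem_or_mem (hGP (separator_mul_mem G o hp))).resolve_left fun hs => ?_
  have := hPS hs
  rw [← vanishingIdeal_affineCone_segreVariety] at this
  exact aeval_one_separator_ne_zero hG o (this _ (one_mem_affineCone_segreVariety n))

/-! ### Irreducible components in the Zariski topology -/

theorem zariski_isClosed_iff {σ : Type*} {Z : Set (σ → ℂ)} :
    @IsClosed _ (zariskiTopology σ) Z ↔ ∃ I : Ideal (MvPolynomial σ ℂ), Z = zeroLocus ℂ I := by
  rw [← @isOpen_compl_iff _ _ (zariskiTopology σ)]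
  change Zᶜᶜ ∈ _ ↔ _
  rw [compl_compl]
  rfl

theorem zariski_isIrreducible {σ : Type*} {S : Set (σ → ℂ)}
    (hS : (vanishingIdeal ℂ S).IsPrime) : @IsIrreducible _ (zariskiTopology σ) S := by
  let := zariskiTopology σ
  refine ⟨?_, isPreirreducible_iff_isClosed_union_isClosed.2 ?_⟩
  · by_contra h
    rw [Set.not_nonempty_iff_eq_empty] at h
    exact hS.ne_top (h ▸ vanishingIdeal_empty)
  · intro Z W hZ hW hZW
    obtain ⟨I, rfl⟩ := zariski_isClosed_iff.1 hZ
    obtain ⟨J, rfl⟩ := zariski_isClosed_iff.1 hW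
    have : I * J ≤ vanishingIdeal ℂ S := by
      refine le_zeroLocus_iff_le_vanishingIdeal.1 (hZW.trans (Set.union_subset ?_ ?_))
      · exact zeroLocus_anti_mono Ideal.mul_le_left
      · exact zeroLocus_anti_mono Ideal.mul_le_right
    exact (hS.mul_le.1 this).imp le_zeroLocus_iff_le_vanishingIdeal.2
      le_zeroLocus_iff_le_vanishingIdeal.2

theorem isIrreducible_of_image_val {X : Type*} [TopologicalSpace X] {Z : Set X} {T : Set Z}
    (h : IsIrreducible (Subtype.val '' T)) : IsIrreducible T := by
  refine ⟨Set.image_nonempty.1 h.1, ?_⟩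
  rintro _ _ ⟨U, hU, rfl⟩ ⟨W, hW, rfl⟩ ⟨a, haT, haU⟩ ⟨b, hbT, hbW⟩
  obtain ⟨_, ⟨c, hcT, rfl⟩, hc⟩ := h.2 U W hU hW ⟨a, ⟨a, haT, rfl⟩, haU⟩ ⟨b, ⟨b, hbT, rfl⟩, hbW⟩
  exact ⟨c, hcT, hc⟩

/-- An irreducible closed `S ⊆ Z` is a component of `Z` if some polynomial `h` that does not vanish
identically on `S` vanishes on `Z \ S`. -/
theorem mem_zariskiComponents {σ : Type*} {S Z : Set (σ → ℂ)} (hSZ : S ⊆ Z)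
    (hprime : (vanishingIdeal ℂ S).IsPrime) (hclosed : zeroLocus ℂ (vanishingIdeal ℂ S) = S)
    {h : MvPolynomial σ ℂ} (hZ : ∀ v ∈ Z, v ∉ S → aeval v h = 0) (hS : ∃ v ∈ S, aeval v h ≠ 0) :
    S ∈ zariskiComponents Z := by
  let := zariskiTopology σ
  have himage : Subtype.val '' (Subtype.val ⁻¹' S : Set Z) = S := by
    rw [Subtype.image_preimage_coe, Set.inter_eq_right.2 hSZ]
  refine ⟨Subtype.val ⁻¹' S, ⟨isIrreducible_of_image_val ?_, fun T hT hST => ?_⟩, himage⟩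
  · rw [himage]
    exact zariski_isIrreducible hprime
  · have hT' : IsIrreducible (Subtype.val '' T) :=
      IsIrreducible.image hT _ continuous_subtype_val.continuousOn
    -- An irreducible T containing S lies in S or in the zero locus of h; the latter is excluded
    -- because h is nonzero somewhere on S.
    have hcover : Subtype.val '' T ⊆ S ∪ zeroLocus ℂ (Ideal.span {h}) := by
      rintro _ ⟨v, -, rfl⟩
      by_cases hv : (v : σ → ℂ) ∈ S
      · exact Or.inl hv
      · right
        rw [zeroLocus_span]
        simpa using hZ v v.2 hv
    rcases isPreirreducible_iff_isClosed_union_isClosed.1 hT'.2 _ _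
      (zariski_isClosed_iff.2 ⟨_, hclosed.symm⟩) (zariski_isClosed_iff.2 ⟨_, rfl⟩) hcover with H | H
    · exact Set.image_subset_iff.1 H
    · obtain ⟨v, hv, hne⟩ := hS
      have := H ⟨⟨v, hSZ hv⟩, hST hv, rfl⟩
      exact absurd (this h (Ideal.mem_span_singleton_self h)) hne

theorem affineCone_segreVariety_mem_zariskiComponents {n : ℕ} {G : SimpleGraph (Fin n)}
    [DecidableRel G.Adj] (hG : G.Connected) :
    affineCone (segreVariety n) ∈ zariskiComponents (zeroLocus ℂ (graphIdeal G)) := by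
  obtain ⟨o⟩ := hG.nonempty
  have hvan := vanishingIdeal_affineCone_segreVariety n
  refine mem_zariskiComponents (h := separator G o) ?_ (hvan ▸ segreIdeal_isPrime n)
    (hvan ▸ zeroLocus_segreIdeal n) (fun v hv hvS => ?_)
    ⟨1, one_mem_affineCone_segreVariety n, aeval_one_separator_ne_zero hG o⟩
  · rw [← zeroLocus_segreIdeal]
    exact zeroLocus_anti_mono (graphIdeal_le_segreIdeal G)
  · rw [← zeroLocus_segreIdeal, mem_zeroLocus_iff] at hvS
    push Not at hvS
    obtain ⟨p, hp, hpv⟩ := hvS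
    have := hv _ (separator_mul_mem G o hp)
    rw [map_mul] at this
    exact (mul_eq_zero.1 this).resolve_right hpv

end Kuramoto

theorem theorem2p10 (n : ℕ) (G : SimpleGraph (Fin n)) [DecidableRel G.Adj] (hG : G.Connected) :
    Kuramoto.segreIdeal n ∈ (Kuramoto.graphIdeal G).minimalPrimes ∧
      MvPolynomial.vanishingIdeal ℂ (Kuramoto.affineCone (Kuramoto.segreVariety n)) =
        Kuramoto.segreIdeal n ∧
      Kuramoto.affineCone (Kuramoto.segreVariety n) ∈
        Kuramoto.zariskiComponents
          (MvPolynomial.zeroLocus ℂ (Kuramoto.graphIdeal G)) :=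
  ⟨Kuramoto.segreIdeal_mem_minimalPrimes hG, Kuramoto.vanishingIdeal_affineCone_segreVariety n,
    Kuramoto.affineCone_segreVariety_mem_zariskiComponents hG⟩
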